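/- Let $X$ be a one-ended $\delta$-hyperbolic geodesic metric space on which a group $G$ acts geometrically (properly and cocompactly by isometries). Here $\delta$-hyperbolic ($\delta\ge 0$) means that for any geodesic triangle with vertices $x,y,z$ and any points $y'\in[x,y]$, $z'\in[x,z]$ with $d(x,y')=d(x,z')\le \frac12\bigl(d(x,y)+d(x,z)-d(y,z)\bigr)$ one has $d(y',z')\le\delta$; one-ended means that $X$ admits a proper ray $[0,\infty)\to X$ and that, for any two proper rays and any compact $D\subset X$, the rays have tails lying in the same component of $X\setminus D$. Let $C$ be an almost extendability constant of $X$, i.e. for all $p,q\in X$ there is a geodesic ray starting at $p$ that passes within a distance $C$ of $q$ (that is, contains a point at distance at most $C$ from $q$). For $M>0$ let $(\ddagger_M)$ be the following property of $X$: there is a number $L>0$ such that for every $R>0$ and any $x,y,z\in X$ with $d(x,y)=d(x,z)=R$ and $d(y,z)\le M$ there is a path of length at most $L$ from $y$ to $z$ in the complement of the open ball of radius $R-C$ centered at $x$. If $(\ddagger_M)$ fails for some $M>0$, then $X$ contains an essentially separating horoball: there are a point $\eta\in\partial X$ and a horoball $B$ centered at $\eta$ such that $X\setminus B$ has at least two components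 each of which contains a geodesic ray that is not asymptotic to $B$ (that is, whose endpoint in $\partial X$ is not $\eta$). Here $\partial X$ is the set of geodesic rays modulo bounded distance, and a horoball centered at $\eta$ is a limit of closed balls whose centers converge to $\eta$, i.e. a set $\{q\in X: h(q)\le 0\}$ where $h(q)=\lim_{n\to\infty}\bigl(d(q,x_n)-R_n\bigr)$ exists for all $q\in X$, for some points $x_n\in X$ converging to $\eta$ in $X\cup\partial X$ and some $R_n\in\mathbb R$. -/

import Mathlib

open Set Filter Topology
open scoped NNReal

noncomputable section

/-- `γ`, restricted to `[0, dist x y]`, is a geodesic segment from `x` to `y`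
(parametrized by arc length). -/
structure IsGeodesicSegment {X : Type*} [MetricSpace X] (γ : ℝ → X) (x y : X) : Prop where
  source : γ 0 = x
  target : γ (dist x y) = y
  dist_eq : ∀ s ∈ Icc (0 : ℝ) (dist x y), ∀ t ∈ Icc (0 : ℝ) (dist x y),
    dist (γ s) (γ t) = |s - t|

/-- A geodesic space: any two points are joined by a geodesic segment. -/
def IsGeodesicSpace (X : Type*) [MetricSpace X] : Prop :=
  ∀ x y : X, ∃ γ : ℝ → X, IsGeodesicSegment γ x y

/-- The Gromov product `(x | y)_p`. -/
def gromovProduct {X : Type*} [MetricSpace X] (p x y : X) : ℝ :=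
  (dist x p + dist y p - dist x y) / 2

/-- A `δ`-hyperbolic space: a geodesic space such that, for the sides `[x, y]` and `[x, z]` of
a geodesic triangle, points at the same distance `t ≤ (y | z)_x` from `x` on the two sides are
at distance at most `δ`. -/
structure IsHyperbolicSpace (X : Type*) [MetricSpace X] (δ : ℝ) : Prop where
  nonneg : 0 ≤ δ
  geodesic : IsGeodesicSpace X
  thin : ∀ (x y z : X) (γ γ' : ℝ → X), IsGeodesicSegment γ x y → IsGeodesicSegment γ' x z →
    ∀ t : ℝ, 0 ≤ t → t ≤ gromovProduct x y z → dist (γ t) (γ' t) ≤ δ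

/-- A geometric action of the (discrete) group `G` on `X`: isometric, proper (every point has a
ball that meets only finitely many of its translates) and cocompact. -/
structure IsGeometricAction (G : Type*) [Group G] (X : Type*) [MetricSpace X]
    [MulAction G X] : Prop where
  isometric : ∀ g : G, Isometry (fun x : X => g • x)
  proper : ∀ x : X, ∃ r : ℝ, 0 < r ∧
    {g : G | (((fun y : X => g • y) '' Metric.ball x r) ∩ Metric.ball x r).Nonempty}.Finite
  cocompact : ∃ K : Set X, IsCompact K ∧ ∀ x : X, ∃ g : G, ∃ k ∈ K, g • k = x

/-- A proper ray: a proper continuous map `[0, ∞) → X`. -/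
def IsProperRay {X : Type*} [MetricSpace X] (c : ℝ≥0 → X) : Prop :=
  Continuous c ∧ ∀ K : Set X, IsCompact K → IsCompact (c ⁻¹' K)

/-- Two rays converge to the same end if for every compact `D` they have tails that lie in the
same component of the complement of `D`. -/
def ConvergeToSameEnd {X : Type*} [MetricSpace X] (c c' : ℝ≥0 → X) : Prop :=
  ∀ D : Set X, IsCompact D → ∃ (N : ℝ≥0) (a : X), a ∈ Dᶜ ∧
    ∀ t : ℝ≥0, N ≤ t → c t ∈ connectedComponentIn Dᶜ a ∧ c' t ∈ connectedComponentIn Dᶜ a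

/-- A one-ended space: there is exactly one class of proper rays converging to the same end. -/
def IsOneEnded (X : Type*) [MetricSpace X] : Prop :=
  (∃ c : ℝ≥0 → X, IsProperRay c) ∧
    ∀ c c' : ℝ≥0 → X, IsProperRay c → IsProperRay c' → ConvergeToSameEnd c c'

/-- A geodesic ray, parametrized by arc length on `[0, ∞)`. -/
structure GeodesicRay (X : Type*) [MetricSpace X] where
  toFun : ℝ≥0 → X
  isometry : Isometry toFun

instance GeodesicRay.instCoeFun (X : Type*) [MetricSpace X] :
    CoeFun (GeodesicRay X) (fun _ => ℝ≥0 → X) :=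
  ⟨GeodesicRay.toFun⟩

/-- Geodesic rays are equivalent if they stay at bounded distance from each other. -/
instance GeodesicRay.instSetoid (X : Type*) [MetricSpace X] : Setoid (GeodesicRay X) where
  r c c' := ∃ K : ℝ, ∀ t : ℝ≥0, dist (c t) (c' t) ≤ K
  iseqv :=
    { refl := fun c => ⟨0, fun t => by simp⟩
      symm := fun ⟨K, h⟩ => ⟨K, fun t => by rw [dist_comm]; exact h t⟩
      trans := fun ⟨K, h⟩ ⟨K', h'⟩ =>
        ⟨K + K', fun t => (dist_triangle _ _ _).trans (add_le_add (h t) (h' t))⟩ }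

/-- The boundary at infinity `∂X`: the set of equivalence classes of geodesic rays. -/
def BoundaryAtInfinity (X : Type*) [MetricSpace X] : Type _ :=
  Quotient (GeodesicRay.instSetoid X)

/-- The endpoint `c(∞) ∈ ∂X` of a geodesic ray `c`. -/
def GeodesicRay.endpoint {X : Type*} [MetricSpace X] (c : GeodesicRay X) :
    BoundaryAtInfinity X :=
  Quotient.mk (GeodesicRay.instSetoid X) c

/-- The points of `X` in the basic neighbourhood `V(c₀, r, D)` of `c₀(∞)` in `X ∪ ∂X`: the
endpoints `x` of geodesic segments `γ` issuing from `c₀(0)`, and extended as constant beyond `x`,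
such that `dist (γ r) (c₀ r) < D`. -/
def basicNhd {X : Type*} [MetricSpace X] (c₀ : GeodesicRay X) (r : ℝ≥0) (D : ℝ) : Set X :=
  {x | ∃ γ : ℝ → X, IsGeodesicSegment γ (c₀ 0) x ∧
    dist (γ (min (r : ℝ) (dist (c₀ 0) x))) (c₀ r) < D}

/-- Convergence in `X ∪ ∂X` of a sequence of points of the `δ`-hyperbolic space `X` to a boundary
point `η`. -/
def ConvergesToBoundary {X : Type*} [MetricSpace X] (δ : ℝ) (x : ℕ → X)
    (η : BoundaryAtInfinity X) : Prop :=
  ∀ D : ℝ, 2 * δ < D → ∀ c₀ : GeodesicRay X, c₀.endpoint = η →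
    ∀ r : ℝ≥0, ∀ᶠ n in atTop, x n ∈ basicNhd c₀ r D

/-- `B` is a (closed) horoball centered at `η`: a limit of closed balls of radius `R n` about
points `x n` converging to `η`, that is, the sublevel set `{h ≤ 0}` of a horofunction
`h = lim (dist · (x n) - R n)`. -/
def IsHoroball {X : Type*} [MetricSpace X] (δ : ℝ) (η : BoundaryAtInfinity X)
    (B : Set X) : Prop :=
  ∃ (x : ℕ → X) (R : ℕ → ℝ) (h : X → ℝ), ConvergesToBoundary δ x η ∧
    (∀ q : X, Tendsto (fun n => dist q (x n) - R n) atTop (𝓝 (h q))) ∧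
    B = {q | h q ≤ 0}

/-- The horoball `B` centered at `η` is essentially separating: its complement has two distinct
components each of which contains a geodesic ray that is not asymptotic to `B`, i.e. whose
endpoint is not `η`. -/
def IsEssentiallySeparating {X : Type*} [MetricSpace X] (η : BoundaryAtInfinity X)
    (B : Set X) : Prop :=
  ∃ a ∈ Bᶜ, ∃ b ∈ Bᶜ, connectedComponentIn Bᶜ a ≠ connectedComponentIn Bᶜ b ∧
    (∃ c : GeodesicRay X, (∀ t, c t ∈ connectedComponentIn Bᶜ a) ∧ c.endpoint ≠ η) ∧
    (∃ c : GeodesicRay X, (∀ t, c t ∈ connectedComponentIn Bᶜ b) ∧ c.endpoint ≠ η)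

/-- `C` is an almost extendability constant of `X`: for all `p` and `q` there is a geodesic ray
from `p` that passes within a distance `C` of `q`. -/
def IsAlmostExtendabilityConstant (X : Type*) [MetricSpace X] (C : ℝ) : Prop :=
  ∀ p q : X, ∃ c : GeodesicRay X, c 0 = p ∧ ∃ t : ℝ≥0, dist (c t) q ≤ C

/-- The property `(‡_M)` of `X`, with respect to the constant `C`. The length of a path is its
total variation. -/
def DoubleDagger (X : Type*) [MetricSpace X] (C M : ℝ) : Prop :=
  ∃ L : ℝ, 0 < L ∧ ∀ R : ℝ, 0 < R → ∀ x y z : X, dist x y = R → dist x z = R → dist y z ≤ M →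
    ∃ γ : Path y z, eVariationOn (fun s => γ s) univ ≤ ENNReal.ofReal L ∧
      ∀ s, γ s ∈ (Metric.ball x (R - C))ᶜ

end

open scoped ENNReal unitInterval

/-! If `DoubleDagger` fails, then for each `n` there are two points at bounded distance from each
other, on a sphere about some `x n`, that no path of length `n` joins outside a slightly smaller
ball of radius `r n`. Cocompactness moves them near a fixed point `p`, and almost extendability
attaches to each a geodesic ray leaving the ball at unit speed (`exists_separatedRays`).

By Arzelà-Ascoli the functions `dist · (x n) - r n` and both families of rays subconverge, to `h`,
`c` and `c'`, and `t ≤ h (c t)`, `t ≤ h (c' t)`. If `c 1` and `c' 1` lay in one component of `{h >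
0}`, a rectifiable path there would join them. By compactness it would avoid the `n`-th ball for
large `n`, contradicting the choice of the points (`SeparatedRays.notMem_connectedComponentIn`).

One-endedness forces `r n → ∞`, since otherwise `{h ≤ 0}` would be compact and yet separate two
proper rays. Hence the `x n` leave every bounded set and subconverge to the endpoint of a ray `b`.
Since `h` tends to `-∞` along `b` but is nonnegative on `c` and `c'`, neither of these is asymptotic
to `b`. -/

/-! ### Paths of bounded length -/

/-- `y` and `z` are joined in `U` by a path of length at most `L`. -/
def JoinedByLength {X : Type*} [MetricSpace X] (U : Set X) (L : ℝ≥0∞) (y z : X) : Prop :=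
  ∃ γ : Path y z, eVariationOn (fun s => γ s) univ ≤ L ∧ ∀ s, γ s ∈ U

namespace JoinedByLength

variable {X : Type*} [MetricSpace X] {U V : Set X} {L L' : ℝ≥0∞} {x y z : X}

theorem mono (h : JoinedByLength U L y z) (hL : L ≤ L') (hU : U ⊆ V) :
    JoinedByLength V L' y z := by
  obtain ⟨γ, h1, h2⟩ := h
  exact ⟨γ, h1.trans hL, fun s => hU (h2 s)⟩

theorem symm (h : JoinedByLength U L y z) : JoinedByLength U L z y := by
  obtain ⟨γ, h1, h2⟩ := h
  refine ⟨γ.symm, ?_, fun s => h2 _⟩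
  refine le_trans ?_ h1
  exact eVariationOn.comp_le_of_antitoneOn (fun s => γ s) unitInterval.symm
    (fun a _ b _ hab => unitInterval.symm_le_symm.2 hab) (mapsTo_univ _ _)

theorem trans (h : JoinedByLength U L x y) (h' : JoinedByLength U L' y z) :
    JoinedByLength U (L + L') x z := by
  obtain ⟨γ, h1, h2⟩ := h
  obtain ⟨γ', h1', h2'⟩ := h'
  refine ⟨γ.trans γ', ?_, fun s => ?_⟩
  · let m : I := ⟨1 / 2, by norm_num, by norm_num⟩
    have hu : (univ : Set I) = Iic m ∪ Ici m := by rw [Iic_union_Ici]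
    rw [hu, eVariationOn.union _ (x := m) ⟨self_mem_Iic, fun _ h => h⟩ ⟨self_mem_Ici, fun _ h => h⟩]
    refine add_le_add (le_trans ?_ h1) (le_trans ?_ h1')
    · have e : EqOn (fun s => (γ.trans γ') s)
          ((fun s => γ s) ∘ fun s : I => projIcc (0 : ℝ) 1 zero_le_one (2 * s)) (Iic m) := by
        intro s hs
        have hs' : (s : ℝ) ≤ 1 / 2 := hs
        have := s.2.1
        simp only [Path.trans_apply, hs', dite_true, Function.comp]
        rw [projIcc_of_mem zero_le_one (x := 2 * (s : ℝ)) ⟨by linarith, by linarith⟩]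
      rw [eVariationOn.congr e]
      refine eVariationOn.comp_le_of_monotoneOn _ _ (fun a _ b _ hab => ?_) (mapsTo_univ _ _)
      exact monotone_projIcc _ (by have : (a : ℝ) ≤ b := hab; linarith)
    · have e : EqOn (fun s => (γ.trans γ') s)
          ((fun s => γ' s) ∘ fun s : I => projIcc (0 : ℝ) 1 zero_le_one (2 * s - 1)) (Ici m) := by
        intro s hs
        have hs' : 1 / 2 ≤ (s : ℝ) := hs
        have := s.2.2
        simp only [Function.comp]
        rw [projIcc_of_mem zero_le_one (x := 2 * (s : ℝ) - 1) ⟨by linarith, by linarith⟩,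
          Path.trans_apply]
        -- At the midpoint `Path.trans` takes its first branch; both branches give `y` there.
        split_ifs with h
        · have hs2 : (s : ℝ) = 1 / 2 := le_antisymm h hs'
          simp [hs2]
        · rfl
      rw [eVariationOn.congr e]
      refine eVariationOn.comp_le_of_monotoneOn _ _ (fun a _ b _ hab => ?_) (mapsTo_univ _ _)
      exact monotone_projIcc _ (by have : (a : ℝ) ≤ b := hab; linarith)
  · rw [Path.trans_apply]
    split_ifs
    exacts [h2 _, h2' _]

theorem smul {G : Type*} [Group G] [MulAction G X] (h : JoinedByLength U L y z) (g : G)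
    (hg : Isometry fun x : X => g • x) (hV : ∀ x ∈ U, g • x ∈ V) :
    JoinedByLength V L (g • y) (g • z) := by
  obtain ⟨γ, h1, h2⟩ := h
  refine ⟨γ.map hg.continuous, ?_, fun s => hV _ (h2 s)⟩
  refine le_trans (le_of_eq ?_) h1
  simp only [Path.map_coe, eVariationOn, Function.comp, hg.edist_eq]

/-- Asking that all points metrically between `y` and `z` lie in `U` spares callers the choice of a
geodesic: the triangle inequality suffices. -/
theorem of_geodesic (hX : IsGeodesicSpace X)
    (h : ∀ p, dist y p + dist p z = dist y z → p ∈ U) :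
    JoinedByLength U (ENNReal.ofReal (dist y z)) y z := by
  obtain ⟨γ, h0, h1, hd⟩ := hX y z
  set d := dist y z with hdd
  have hd0 : 0 ≤ d := dist_nonneg
  have mem : ∀ s : I, (s : ℝ) * d ∈ Icc 0 d := fun s =>
    ⟨mul_nonneg s.2.1 hd0, mul_le_of_le_one_left hd0 s.2.2⟩
  have hlip : LipschitzWith d.toNNReal (fun s : I => γ (s * d)) := by
    refine LipschitzWith.of_dist_le_mul fun s t => ?_
    rw [hd _ (mem s) _ (mem t), ← sub_mul, abs_mul, abs_of_nonneg hd0, Real.coe_toNNReal _ hd0,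
      mul_comm]
    rfl
  refine ⟨⟨⟨fun s : I => γ (s * d), hlip.continuous⟩, by simp [h0], by simp [h1]⟩, ?_, ?_⟩
  · have h2 := (hlip.lipschitzOnWith (s := univ)).comp_eVariationOn_le (g := fun s : I => s)
      (s := univ) (mapsTo_univ _ _)
    refine h2.trans ?_
    have h3 : eVariationOn (fun s : I => s) univ ≤ 1 := by
      have := MonotoneOn.eVariationOn_eq (f := fun s : I => (s : ℝ)) (s := univ)
        (a := 0) (b := 1) (fun a _ b _ h => h) (mem_univ _) (mem_univ _)
      have h4 : (univ : Set I) ∩ Icc 0 1 = univ :=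
        inter_eq_left.2 fun s _ => ⟨unitInterval.nonneg', unitInterval.le_one'⟩
      rw [h4] at this
      refine le_trans (le_of_eq (Eq.trans ?_ this)) (by simp)
      rfl
    calc _ ≤ (d.toNNReal : ℝ≥0∞) * 1 := by gcongr
      _ = _ := by simp [ENNReal.ofReal]
  · intro s
    apply h
    have e1 : dist (γ (s * d)) y = s * d := by
      rw [← h0, hd _ (mem s) _ ⟨le_rfl, hd0⟩, sub_zero, abs_of_nonneg (mem s).1]
    have e2 : dist (γ (s * d)) z = d - s * d := by
      rw [← h1, hd _ (mem s) _ ⟨hd0, le_rfl⟩, abs_of_nonpos (by linarith [(mem s).2])]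
      ring
    change dist y (γ (s * d)) + dist (γ (s * d)) z = d
    rw [dist_comm y, e1, e2]
    ring

/-- Points of an open set lying in the same component are joined by a rectifiable path. -/
theorem exists_of_mem_connectedComponentIn (hX : IsGeodesicSpace X) (hU : IsOpen U)
    (hy : y ∈ U) (hz : z ∈ connectedComponentIn U y) :
    ∃ L : ℝ≥0, JoinedByLength U L y z := by
  have near : ∀ p ∈ U, ∃ ε > 0, ∀ q ∈ Metric.ball p ε, ∃ L : ℝ≥0, JoinedByLength U L p q := by
    intro p hp
    obtain ⟨ε, hε, hb⟩ := Metric.isOpen_iff.1 hU p hp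
    refine ⟨ε, hε, fun q hq => ⟨(dist p q).toNNReal, of_geodesic hX fun r hr => hb ?_⟩⟩
    rw [Metric.mem_ball] at hq ⊢
    rw [dist_comm] at hq ⊢
    linarith [dist_nonneg (x := r) (y := q)]
  -- Both `A` and `U \ A` are open, so the preconnected component, which meets `A`, lies in `A`.
  let A : Set X := {q | ∃ L : ℝ≥0, JoinedByLength U L y q}
  have hA : IsOpen A := by
    refine Metric.isOpen_iff.2 fun p ⟨L, hL⟩ => ?_
    obtain ⟨ε, hε, hb⟩ := near p (by obtain ⟨γ, -, h⟩ := hL; simpa using h 1)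
    refine ⟨ε, hε, fun q hq => ?_⟩
    obtain ⟨L', hL'⟩ := hb q hq
    exact ⟨L + L', by simpa using hL.trans hL'⟩
  have hB : IsOpen (U \ A) := by
    refine Metric.isOpen_iff.2 fun p ⟨hp, hpA⟩ => ?_
    obtain ⟨ε, hε, hb⟩ := near p hp
    refine ⟨ε, hε, fun q hq => ?_⟩
    obtain ⟨L', hL'⟩ := hb q hq
    refine ⟨by obtain ⟨γ, -, h⟩ := hL'; simpa using h 1, fun ⟨L, hL⟩ => hpA ?_⟩
    exact ⟨L + L', by simpa using hL.trans hL'.symm⟩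
  have hyA : y ∈ A := by
    obtain ⟨ε, hε, hb⟩ := near y hy
    exact hb y (Metric.mem_ball_self hε)
  refine isPreconnected_connectedComponentIn.subset_left_of_subset_union hA hB
    disjoint_sdiff_right ?_ ⟨y, mem_connectedComponentIn hy, hyA⟩ hz
  intro q hq
  by_cases h : q ∈ A
  exacts [Or.inl h, Or.inr ⟨connectedComponentIn_subset _ _ hq, h⟩]

end JoinedByLength

/-! ### Spaces with a geometric action are proper -/

/-- In a geometric action, only finitely many group elements move a compact set near a point. -/
theorem IsGeometricAction.exists_finite_near {X G : Type*} [MetricSpace X] [Group G]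
    [MulAction G X] (hG : IsGeometricAction G X) {K : Set X} (hK : IsCompact K) (y : X) :
    ∃ r > 0, {g : G | ∃ k ∈ K, g • k ∈ Metric.ball y r}.Finite := by
  obtain ⟨r, hr, hfin⟩ := hG.proper y
  have key : ∀ x : X, {g : G | g • x ∈ Metric.ball y r}.Finite := by
    intro x
    rcases Set.eq_empty_or_nonempty {g : G | g • x ∈ Metric.ball y r} with h | ⟨g₀, h₀⟩
    · rw [h]; exact finite_empty
    -- If `g` and `g₀` both send `x` into the ball, then `g * g₀⁻¹` sends a point of the ball into
    -- the ball.
    · refine (hfin.image fun h => h * g₀).subset fun g hg => ⟨g * g₀⁻¹, ?_, by simp⟩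
      exact ⟨g • x, ⟨g₀ • x, h₀, by simp [mul_smul]⟩, hg⟩
  obtain ⟨t, -, ht⟩ := hK.elim_finite_subcover_image (b := K)
    (c := fun x => Metric.ball x (r / 2)) (fun _ _ => Metric.isOpen_ball)
    (fun x hx => mem_iUnion₂.2 ⟨x, hx, Metric.mem_ball_self (half_pos hr)⟩)
  refine ⟨r / 2, half_pos hr, (ht.1.biUnion fun x _ => key x).subset ?_⟩
  rintro g ⟨k, hk, hgk⟩
  obtain ⟨x, hx, hkx⟩ := mem_iUnion₂.1 (ht.2 hk)
  refine mem_iUnion₂.2 ⟨x, hx, ?_⟩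
  have h1 : dist (g • x) (g • k) = dist x k := (hG.isometric g).dist_eq x k
  have h2 : dist k x < r / 2 := hkx
  have h3 : dist (g • k) y < r / 2 := hgk
  have := dist_triangle (g • x) (g • k) y
  change dist (g • x) y < r
  rw [dist_comm k x] at h2
  linarith

/-- Finitely many translates of the compact set `K` cover a small ball about each point. Compactness
of `K` makes the radius uniform on `K`, and the action carries it to all of `X`. -/
theorem IsGeometricAction.exists_isCompact_closedBall {X G : Type*} [MetricSpace X] [Group G]
    [MulAction G X] (hG : IsGeometricAction G X) :
    ∃ ρ > 0, ∀ x : X, IsCompact (Metric.closedBall x ρ) := by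
  obtain ⟨K, hK, hcov⟩ := hG.cocompact
  have hloc : ∀ y : X, ∃ r > 0, IsCompact (Metric.closedBall y r) := by
    intro y
    obtain ⟨r, hr, hfin⟩ := hG.exists_finite_near hK y
    have hc : IsCompact (⋃ g ∈ {g : G | ∃ k ∈ K, g • k ∈ Metric.ball y r},
        (fun x : X => g • x) '' K) :=
      hfin.isCompact_biUnion fun g _ => hK.image (hG.isometric g).continuous
    refine ⟨r / 2, half_pos hr, hc.of_isClosed_subset Metric.isClosed_closedBall fun q hq => ?_⟩
    obtain ⟨g, k, hk, rfl⟩ := hcov q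
    refine mem_iUnion₂.2 ⟨g, ⟨k, hk, ?_⟩, k, hk, rfl⟩
    exact Metric.closedBall_subset_ball (half_lt_self hr) hq
  have hunif : ∃ ρ > 0, ∀ x ∈ K, IsCompact (Metric.closedBall x ρ) := by
    refine hK.induction_on (p := fun S => ∃ ρ > 0, ∀ x ∈ S, IsCompact (Metric.closedBall x ρ))
      ⟨1, one_pos, by simp⟩ ?_ ?_ ?_
    · rintro s t hst ⟨ρ, hρ, h⟩
      exact ⟨ρ, hρ, fun x hx => h x (hst hx)⟩
    · rintro s t ⟨ρ, hρ, h⟩ ⟨ρ', hρ', h'⟩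
      refine ⟨min ρ ρ', lt_min hρ hρ', fun x hx => ?_⟩
      rcases hx with hx | hx
      · exact (h x hx).of_isClosed_subset Metric.isClosed_closedBall
          (Metric.closedBall_subset_closedBall (min_le_left _ _))
      · exact (h' x hx).of_isClosed_subset Metric.isClosed_closedBall
          (Metric.closedBall_subset_closedBall (min_le_right _ _))
    · intro y _
      obtain ⟨r, hr, h⟩ := hloc y
      refine ⟨Metric.ball y (r / 2), mem_nhdsWithin_of_mem_nhds
        (Metric.ball_mem_nhds _ (half_pos hr)), r / 2, half_pos hr, fun x hx => ?_⟩
      refine h.of_isClosed_subset Metric.isClosed_closedBall (Metric.closedBall_subset_closedBall' ?_)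
      have : dist x y < r / 2 := hx
      linarith
  obtain ⟨ρ, hρ, h⟩ := hunif
  refine ⟨ρ, hρ, fun x => ?_⟩
  obtain ⟨g, k, hk, rfl⟩ := hcov x
  refine ((h k hk).image (hG.isometric g).continuous).of_isClosed_subset
    Metric.isClosed_closedBall fun q hq => ⟨g⁻¹ • q, ?_, by simp⟩
  have h1 := (hG.isometric g).dist_eq (g⁻¹ • q) k
  simp only [smul_inv_smul] at h1
  rw [Metric.mem_closedBall, ← h1]
  exact hq

/-- A geodesic space whose balls of some fixed radius are compact is proper. -/
theorem IsGeodesicSpace.properSpace {X : Type*} [MetricSpace X] (hX : IsGeodesicSpace X) {ρ : ℝ}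
    (hρ : 0 < ρ) (h : ∀ x : X, IsCompact (Metric.closedBall x ρ)) : ProperSpace X := by
  -- Radii grow by `ρ / 2` only: one half of `ρ` is spent retreating along a geodesic into the
  -- previous ball, the other on reaching a point of a finite net.
  have step : ∀ (x : X) (n : ℕ), IsCompact (Metric.closedBall x (n * (ρ / 2))) := by
    intro x n
    induction n with
    | zero => simp
    | succ n ih =>
      obtain ⟨t, -, ht⟩ := ih.elim_finite_subcover_image
        (b := Metric.closedBall x (n * (ρ / 2))) (c := fun x => Metric.ball x (ρ / 2))
        (fun _ _ => Metric.isOpen_ball)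
        (fun x hx => mem_iUnion₂.2 ⟨x, hx, Metric.mem_ball_self (half_pos hρ)⟩)
      refine (ht.1.isCompact_biUnion fun y _ => h y).of_isClosed_subset
        Metric.isClosed_closedBall fun q hq => ?_
      have hq' : dist x q ≤ (n + 1) * (ρ / 2) := by
        rw [dist_comm]; simpa using hq
      obtain ⟨γ, h0, h1, hd⟩ := hX x q
      have hn : 0 ≤ n * (ρ / 2) := by positivity
      have hm : min (n * (ρ / 2)) (dist x q) ∈ Icc 0 (dist x q) :=
        ⟨le_min hn dist_nonneg, min_le_right _ _⟩
      set p := γ (min (n * (ρ / 2)) (dist x q))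
      have e1 : dist p x ≤ n * (ρ / 2) := by
        rw [← h0, hd _ hm _ ⟨le_rfl, dist_nonneg⟩, sub_zero, abs_of_nonneg hm.1]
        exact min_le_left _ _
      have e2 : dist q p ≤ ρ / 2 := by
        rw [← h1, hd _ ⟨dist_nonneg, le_rfl⟩ _ hm, abs_of_nonneg (by linarith [hm.2])]
        rcases min_cases (n * (ρ / 2)) (dist x q) with h | h <;> linarith
      obtain ⟨y, hy, hpy⟩ := mem_iUnion₂.1 (ht.2 (Metric.mem_closedBall.2 e1))
      have e3 : dist p y < ρ / 2 := hpy
      refine mem_iUnion₂.2 ⟨y, hy, ?_⟩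
      rw [Metric.mem_closedBall]
      linarith [dist_triangle q p y]
  refine ⟨fun x r => ?_⟩
  obtain ⟨n, hn⟩ := exists_nat_ge (r / (ρ / 2))
  refine (step x n).of_isClosed_subset Metric.isClosed_closedBall
    (Metric.closedBall_subset_closedBall ?_)
  rwa [div_le_iff₀ (by positivity)] at hn

/-! ### Limits of 1-Lipschitz maps -/

/-- A pointwise Arzelà-Ascoli theorem: Tychonoff gives convergence on a dense sequence, and the
common Lipschitz bound extends it to every point. It serves for horofunctions, rays and segments
alike. -/
theorem exists_subseq_tendsto_of_lipschitz {S Y : Type*} [PseudoMetricSpace S]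
    [TopologicalSpace.SeparableSpace S] [MetricSpace Y] [ProperSpace Y] (f : ℕ → S → Y)
    (hf : ∀ n s t, dist (f n s) (f n t) ≤ dist s t)
    (hb : ∀ s, ∃ (y : Y) (r : ℝ), ∀ n, dist (f n s) y ≤ r) :
    ∃ (φ : ℕ → ℕ) (g : S → Y), StrictMono φ ∧
      ∀ s, Tendsto (fun n => f (φ n) s) atTop (𝓝 (g s)) := by
  rcases isEmpty_or_nonempty S with hS | hS
  · exact ⟨id, fun s => (hS.false s).elim, strictMono_id, fun s => (hS.false s).elim⟩
  choose c r hcr using hb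
  obtain ⟨u, hu⟩ := TopologicalSpace.exists_dense_seq S
  obtain ⟨a, -, φ, hφ, ha⟩ := (isCompact_univ_pi fun i : ℕ =>
    isCompact_closedBall (c (u i)) (r (u i))).tendsto_subseq
      (x := fun n i => f n (u i)) fun n i _ => hcr (u i) n
  rw [tendsto_pi_nhds] at ha
  have hlim : ∀ s, ∃ y, Tendsto (fun n => f (φ n) s) atTop (𝓝 y) := by
    intro s
    refine cauchySeq_tendsto_of_complete (Metric.cauchySeq_iff.2 fun ε hε => ?_)
    obtain ⟨i, hi⟩ := hu.exists_dist_lt s (by positivity : 0 < ε / 3)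
    obtain ⟨N, hN⟩ := Metric.cauchySeq_iff.1 (ha i).cauchySeq (ε / 3) (by positivity)
    refine ⟨N, fun m hm n hn => ?_⟩
    have h1 : dist (f (φ m) (u i)) (f (φ n) (u i)) < ε / 3 := hN m hm n hn
    have h2 := hf (φ m) s (u i)
    have h3 := hf (φ n) s (u i)
    rw [dist_comm (f (φ n) s)] at h3
    have h4 := dist_triangle4 (f (φ m) s) (f (φ m) (u i)) (f (φ n) (u i)) (f (φ n) s)
    linarith
  choose g hg using hlim
  exact ⟨φ, g, hφ, hg⟩

/-- If 1-Lipschitz functions converge pointwise to a function that is positive on a compact set,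
they are eventually positive on this set. -/
theorem eventually_pos_of_tendsto_lipschitz {S : Type*} [PseudoMetricSpace S] {f : ℕ → S → ℝ}
    {h : S → ℝ} (hf : ∀ n s t, |f n s - f n t| ≤ dist s t)
    (hlim : ∀ s, Tendsto (fun n => f n s) atTop (𝓝 (h s))) {K : Set S} (hK : IsCompact K)
    (hpos : ∀ s ∈ K, 0 < h s) : ∀ᶠ n in atTop, ∀ s ∈ K, 0 < f n s := by
  refine hK.induction_on (p := fun K => ∀ᶠ n in atTop, ∀ s ∈ K, 0 < f n s) (by simp) ?_ ?_ ?_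
  · intro s t hst ht
    filter_upwards [ht] with n hn x hx using hn x (hst hx)
  · intro s t hs ht
    filter_upwards [hs, ht] with n hn hn' x hx using hx.elim (hn x) (hn' x)
  · intro x hx
    have hx0 := hpos x hx
    refine ⟨Metric.ball x (h x / 2), mem_nhdsWithin_of_mem_nhds
      (Metric.ball_mem_nhds _ (half_pos hx0)), ?_⟩
    filter_upwards [(hlim x).eventually (lt_mem_nhds (half_lt_self hx0))] with n hn s hs
    have h1 := abs_le.1 (hf n s x)
    have h2 : dist s x < h x / 2 := hs
    linarith [h1.1]

/-! ### Geodesic rays moving away from a ball -/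

theorem GeodesicRay.dist_eq {X : Type*} [MetricSpace X] (c : GeodesicRay X) (s t : ℝ≥0) :
    dist (c s) (c t) = |(s : ℝ) - t| :=
  (c.isometry.dist_eq s t).trans (NNReal.dist_eq s t)

/-- The ray `t ↦ c (a + t)`. -/
def GeodesicRay.shift {X : Type*} [MetricSpace X] (c : GeodesicRay X) (a : ℝ≥0) :
    GeodesicRay X :=
  ⟨fun t => c (a + t), Isometry.of_dist_eq fun s t => by
    rw [c.dist_eq, NNReal.dist_eq]; push_cast; congr 1; ring⟩

theorem GeodesicRay.shift_apply {X : Type*} [MetricSpace X] (c : GeodesicRay X) (a t : ℝ≥0) :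
    c.shift a t = c (a + t) := rfl

theorem GeodesicRay.isProperRay {X : Type*} [MetricSpace X] (c : GeodesicRay X) :
    IsProperRay c :=
  ⟨c.isometry.continuous, fun _ hK => c.isometry.isClosedEmbedding.isCompact_preimage hK⟩

/-- A geodesic ray from `x` passing near `y` and shifted to start near `y` moves away from `x`. -/
theorem IsAlmostExtendabilityConstant.exists_ray {X : Type*} [MetricSpace X] {C : ℝ}
    (hC : IsAlmostExtendabilityConstant X C) (x y : X) :
    ∃ u : GeodesicRay X, dist (u 0) y ≤ C ∧ (∀ t, dist x y - C + t ≤ dist (u t) x) ∧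
      dist (u 0) x ≤ dist x y - C + 2 * C := by
  obtain ⟨c, rfl, a, ha⟩ := hC x y
  have key : ∀ t, dist (c.shift a t) (c 0) = a + t := fun t => by
    rw [c.shift_apply, c.dist_eq]
    simp only [NNReal.coe_add, NNReal.coe_zero, sub_zero]
    exact abs_of_nonneg (by positivity)
  have h0 : dist (c a) (c 0) = a := by simp [c.dist_eq]
  have h1 := dist_triangle (c 0) (c a) y
  have h2 := dist_triangle (c a) y (c 0)
  rw [dist_comm (c 0) (c a)] at h1
  rw [dist_comm y] at h2
  refine ⟨c.shift a, by simpa [c.shift_apply] using ha, fun t => ?_, ?_⟩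
  · rw [key]; linarith
  · rw [key]; simp only [NNReal.coe_zero]; linarith

/-- Geodesic rays `u` and `v`, starting near `p` and at distance about `r` from `x`, that move away
from the ball of radius `r` about `x` and are not joined by a path of length `L` outside it. -/
structure SeparatedRays {X : Type*} [MetricSpace X] (p : X) (ρ A : ℝ) (L : ℝ≥0∞) (x : X) (r : ℝ)
    (u v : GeodesicRay X) : Prop where
  dist_left : dist (u 0) p ≤ ρ
  dist_right : dist (v 0) p ≤ ρ
  away_left : ∀ t, r + t ≤ dist (u t) x
  away_right : ∀ t, r + t ≤ dist (v t) x
  start : dist (u 0) x ≤ r + A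
  not_joined : ¬ JoinedByLength (Metric.ball x r)ᶜ L (u 1) (v 1)

/-- The beginning of a shifted ray as in `exists_ray` is connected to `y` outside the ball. -/
theorem joinedByLength_ray {X : Type*} [MetricSpace X] (hX : IsGeodesicSpace X) {C : ℝ}
    {x y : X} {u : GeodesicRay X} (h0 : dist (u 0) y ≤ C)
    (h1 : ∀ t, dist x y - C + t ≤ dist (u t) x) :
    JoinedByLength (Metric.ball x (dist x y - C))ᶜ (ENNReal.ofReal (C + 1)) y (u 1) := by
  have hC : 0 ≤ C := dist_nonneg.trans h0
  have a1 := JoinedByLength.of_geodesic hX (U := (Metric.ball x (dist x y - C))ᶜ)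
    (y := y) (z := u 0) fun p hp => by
      rw [mem_compl_iff, Metric.mem_ball, not_lt]
      have := dist_triangle x p y
      rw [dist_comm x p, dist_comm p y] at this
      rw [dist_comm y (u 0)] at hp
      linarith [dist_nonneg (x := p) (y := u 0)]
  have d1 : dist (u 0) (u 1) = 1 := by simp [u.dist_eq]
  -- Each point here is within 1 of `u 1`, which is at least 1 outside the ball.
  have a2 := JoinedByLength.of_geodesic hX (U := (Metric.ball x (dist x y - C))ᶜ)
    (y := u 0) (z := u 1) fun p hp => by
      rw [mem_compl_iff, Metric.mem_ball, not_lt]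
      have := dist_triangle (u 1) p x
      have h2 := h1 1
      rw [dist_comm (u 1) p] at this
      rw [d1] at hp
      simp only [NNReal.coe_one] at h2
      linarith [dist_nonneg (x := u 0) (y := p)]
  refine (a1.trans a2).mono ?_ subset_rfl
  rw [d1, ← ENNReal.ofReal_add dist_nonneg zero_le_one, dist_comm]
  exact ENNReal.ofReal_le_ofReal (by linarith)

theorem exists_separatedRays {X G : Type*} [MetricSpace X] [Group G] [MulAction G X] {C M : ℝ}
    (hX : IsGeodesicSpace X) (hG : IsGeometricAction G X)
    (hC : IsAlmostExtendabilityConstant X C) (hfail : ¬ DoubleDagger X C M) :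
    ∃ (p : X) (ρ : ℝ), ∀ L : ℝ≥0, ∃ (x : X) (r : ℝ) (u v : GeodesicRay X),
      SeparatedRays p ρ (2 * C) L x r u v := by
  have hfail' : ∀ L : ℝ≥0, ∃ x y z : X, dist x y = dist x z ∧ dist y z ≤ M ∧
      ¬ JoinedByLength (Metric.ball x (dist x y - C))ᶜ L y z := by
    intro L
    by_contra! hcon
    -- `DoubleDagger` wants a positive bound, and `L` may be 0.
    refine hfail ⟨L + 1, by positivity, ?_⟩
    rintro R - x y z rfl hz hyz
    obtain ⟨γ, h1, h2⟩ := hcon x y z hz.symm hyz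
    refine ⟨γ, h1.trans ?_, h2⟩
    rw [ENNReal.ofReal_add L.coe_nonneg zero_le_one, ENNReal.ofReal_coe_nnreal]
    exact le_self_add
  obtain ⟨K, hK, hcov⟩ := hG.cocompact
  obtain ⟨x₀, -⟩ := hfail' 0
  obtain ⟨ρ, hρ⟩ := hK.isBounded.subset_closedBall x₀
  refine ⟨x₀, ρ + (M + C), fun L => ?_⟩
  -- The two extra terms pay for the paths from `y` to `u 1` and from `v 1` to `z`.
  obtain ⟨x, y, z, hxyz, hyz, hnot⟩ := hfail' (L + ((C + 1).toNNReal + (C + 1).toNNReal))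
  obtain ⟨g, k, hk, rfl⟩ := hcov y
  have hg := hG.isometric g⁻¹
  have e0 : ∀ a, dist (g⁻¹ • a) (g⁻¹ • g • k) = dist a (g • k) := fun a => hg.dist_eq a _
  simp only [inv_smul_smul] at e0
  have e1 : dist (g⁻¹ • x) (g⁻¹ • z) = dist x z := hg.dist_eq x z
  obtain ⟨u, hu0, hu1, hu2⟩ := hC.exists_ray (g⁻¹ • x) k
  obtain ⟨v, hv0, hv1, -⟩ := hC.exists_ray (g⁻¹ • x) (g⁻¹ • z)
  have ju := joinedByLength_ray hX hu0 hu1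
  have jv := joinedByLength_ray hX hv0 hv1
  have hk0 : dist k x₀ ≤ ρ := hρ hk
  have hM : 0 ≤ M := dist_nonneg.trans hyz
  refine ⟨g⁻¹ • x, dist (g⁻¹ • x) k - C, u, v, ?_, ?_, hu1, ?_, hu2, fun hj => hnot ?_⟩
  · linarith [dist_triangle (u 0) k x₀]
  · have := dist_triangle4 (v 0) (g⁻¹ • z) k x₀
    rw [e0, dist_comm z] at this
    linarith
  · rwa [e0, hxyz, ← e1]
  · rw [e1, ← hxyz, ← e0] at jv
    have := ((ju.trans (hj.trans jv.symm)).smul (V := (Metric.ball x (dist x (g • k) - C))ᶜ) g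
      (hG.isometric g) ?_)
    · rw [smul_inv_smul] at this
      refine this.mono ?_ subset_rfl
      push_cast
      rw [ENNReal.ofReal]
      exact le_of_eq (by ring)
    · intro a ha
      have e2 : dist (g • a) (g • g⁻¹ • x) = dist a (g⁻¹ • x) := (hG.isometric g).dist_eq a _
      rw [smul_inv_smul] at e2
      rw [mem_compl_iff, Metric.mem_ball] at ha ⊢
      rwa [e2, ← e0]

/-! ### The limiting horofunction -/

theorem abs_dist_sub_sub_le {X : Type*} [MetricSpace X] (x q q' : X) (r : ℝ) :
    |(dist q x - r) - (dist q' x - r)| ≤ dist q q' := by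
  rw [sub_sub_sub_cancel_right]
  exact abs_dist_sub_le q q' x

/-- The limit of geodesic rays. -/
theorem exists_subseq_tendsto_ray {X : Type*} [MetricSpace X] [ProperSpace X]
    (u : ℕ → GeodesicRay X) {p : X} {ρ : ℝ} (hu : ∀ n, dist (u n 0) p ≤ ρ) :
    ∃ (φ : ℕ → ℕ) (c : GeodesicRay X), StrictMono φ ∧
      ∀ t, Tendsto (fun n => u (φ n) t) atTop (𝓝 (c t)) := by
  obtain ⟨φ, c, hφ, hc⟩ := exists_subseq_tendsto_of_lipschitz (fun n => u n)
    (fun n s t => ((u n).isometry.dist_eq s t).le) fun s => ⟨p, s + ρ, fun n => by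
      refine (dist_triangle _ (u n 0) p).trans (add_le_add ?_ (hu n))
      simp [(u n).dist_eq]⟩
  refine ⟨φ, ⟨c, Isometry.of_dist_eq fun s t => ?_⟩, hφ, hc⟩
  refine tendsto_nhds_unique ((hc s).dist (hc t)) ?_
  simp only [(u _).isometry.dist_eq]
  exact tendsto_const_nhds

/-- The normalized distance functions are bounded at each point because `u n 0` stays near `p` and
its distance from `x n` lies between `r n` and `r n + A`. -/
theorem SeparatedRays.exists_subseq {X : Type*} [MetricSpace X] [ProperSpace X] {p : X} {ρ A : ℝ}
    {x : ℕ → X} {r : ℕ → ℝ} {u v : ℕ → GeodesicRay X}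
    (H : ∀ n : ℕ, SeparatedRays p ρ A n (x n) (r n) (u n) (v n)) :
    ∃ (φ : ℕ → ℕ) (h : X → ℝ) (c c' : GeodesicRay X), StrictMono φ ∧
      (∀ q, Tendsto (fun n => dist q (x (φ n)) - r (φ n)) atTop (𝓝 (h q))) ∧
      (∀ t, Tendsto (fun n => u (φ n) t) atTop (𝓝 (c t))) ∧
      (∀ t, Tendsto (fun n => v (φ n) t) atTop (𝓝 (c' t))) := by
  obtain ⟨φ₁, h, hφ₁, hh⟩ := exists_subseq_tendsto_of_lipschitz
    (fun n q => dist q (x n) - r n)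
    (fun n s t => (Real.dist_eq _ _).trans_le (abs_dist_sub_sub_le _ _ _ _))
    fun q => ⟨0, dist q p + ρ + |A|, fun n => by
      have h0 := (H n).away_left 0
      have h1 := (H n).start
      have h2 := (H n).dist_left
      have h3 := abs_le.1 (abs_dist_sub_le q (u n 0) (x n))
      have h4 := dist_triangle_right q (u n 0) p
      rw [NNReal.coe_zero] at h0
      rw [Real.dist_eq, sub_zero, abs_le]
      constructor <;> linarith [le_abs_self A, abs_nonneg A, h3.1, h3.2]⟩
  obtain ⟨φ₂, c, hφ₂, hc⟩ := exists_subseq_tendsto_ray (fun n => u (φ₁ n))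
    fun n => (H _).dist_left
  obtain ⟨φ₃, c', hφ₃, hc'⟩ := exists_subseq_tendsto_ray (fun n => v (φ₁ (φ₂ n)))
    fun n => (H _).dist_right
  exact ⟨φ₁ ∘ φ₂ ∘ φ₃, h, c, c', hφ₁.comp (hφ₂.comp hφ₃),
    fun q => (hh q).comp (hφ₂.comp hφ₃).tendsto_atTop,
    fun t => (hc t).comp hφ₃.tendsto_atTop, hc'⟩

/-- The functions `dist · (x n) - r n` are 1-Lipschitz, so moving the evaluation point from `u n` to
its limit costs nothing in the limit. -/
theorem le_of_tendsto_away {X : Type*} [MetricSpace X] {x : ℕ → X} {r : ℕ → ℝ} {h : X → ℝ}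
    (hh : ∀ q, Tendsto (fun n => dist q (x n) - r n) atTop (𝓝 (h q)))
    {u : ℕ → X} {a : X} {t : ℝ} (hu : Tendsto u atTop (𝓝 a))
    (hut : ∀ n, r n + t ≤ dist (u n) (x n)) : t ≤ h a := by
  have h1 : Tendsto (fun n => dist a (x n) - r n + dist (u n) a) atTop (𝓝 (h a + 0)) :=
    (hh a).add (tendsto_iff_dist_tendsto_zero.1 hu)
  rw [add_zero] at h1
  refine ge_of_tendsto' h1 fun n => ?_
  linarith [hut n, dist_triangle (u n) a (x n)]

theorem continuous_of_tendsto_dist_sub {X : Type*} [MetricSpace X] {x : ℕ → X} {r : ℕ → ℝ}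
    {h : X → ℝ} (hh : ∀ q, Tendsto (fun n => dist q (x n) - r n) atTop (𝓝 (h q))) :
    Continuous h := by
  refine (LipschitzWith.of_dist_le_mul (K := 1) fun q q' => ?_).continuous
  rw [NNReal.coe_one, one_mul]
  refine le_of_tendsto' ((hh q).dist (hh q')) fun n => ?_
  exact (Real.dist_eq _ _).trans_le (abs_dist_sub_sub_le _ _ _ _)

/-- The limits of separated rays start in different components of the complement of the
limiting horoball. -/
theorem SeparatedRays.notMem_connectedComponentIn {X : Type*} [MetricSpace X]
    (hX : IsGeodesicSpace X) {p : X} {ρ A : ℝ}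
    {x : ℕ → X} {r : ℕ → ℝ} {u v : ℕ → GeodesicRay X}
    (H : ∀ n : ℕ, SeparatedRays p ρ A n (x n) (r n) (u n) (v n)) {h : X → ℝ}
    {a b : X} (hh : ∀ q, Tendsto (fun n => dist q (x n) - r n) atTop (𝓝 (h q)))
    (hu : Tendsto (fun n => u n 1) atTop (𝓝 a)) (hv : Tendsto (fun n => v n 1) atTop (𝓝 b)) :
    b ∉ connectedComponentIn {q | h q ≤ 0}ᶜ a := by
  intro hb
  have hcont := continuous_of_tendsto_dist_sub hh
  have ha : 1 ≤ h a := le_of_tendsto_away hh hu fun n => by simpa using (H n).away_left 1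
  have hopen : IsOpen {q | h q ≤ 0}ᶜ := (isClosed_le hcont continuous_const).isOpen_compl
  obtain ⟨L, γ, hγ, hγU⟩ := JoinedByLength.exists_of_mem_connectedComponentIn hX hopen
    (by simp only [mem_compl_iff, mem_ofPred_eq]; linarith) hb
  have hev := eventually_pos_of_tendsto_lipschitz
    (fun n q q' => abs_dist_sub_sub_le (x n) q q' (r n)) hh (isCompact_range γ.continuous)
    (by rintro _ ⟨s, rfl⟩; exact not_le.1 (hγU s))
  have near : ∀ {w : GeodesicRay X} {q y : X} {R : ℝ}, R + 1 ≤ dist (w 1) y →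
      dist (w 1) q < 1 → JoinedByLength (Metric.ball y R)ᶜ 1 (w 1) q := by
    intro w q y R hw hq
    refine (JoinedByLength.of_geodesic hX fun s hs => ?_).mono
      (by simpa using ENNReal.ofReal_le_ofReal hq.le) subset_rfl
    rw [mem_compl_iff, Metric.mem_ball, not_lt]
    linarith [dist_triangle (w 1) s y, dist_nonneg (x := s) (y := q)]
  -- The limit path has length at most `L`; each end costs at most 1 to reach `u n 1` or `v n 1`.
  obtain ⟨N, hN⟩ := exists_nat_ge (1 + (L + 1) : ℝ≥0)
  obtain ⟨n, hn, hun, hvn, hnN⟩ := (hev.and ((hu.eventually (Metric.ball_mem_nhds a one_pos)).and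
    ((hv.eventually (Metric.ball_mem_nhds b one_pos)).and (eventually_ge_atTop N)))).exists
  have j1 := near (by simpa using (H n).away_left 1) hun
  have j2 := near (by simpa using (H n).away_right 1) hvn
  have j : JoinedByLength (Metric.ball (x n) (r n))ᶜ L a b := by
    refine ⟨γ, hγ, fun s => ?_⟩
    rw [mem_compl_iff, Metric.mem_ball, not_lt]
    linarith [hn _ ⟨s, rfl⟩]
  refine (H n).not_joined ((j1.trans (j.trans j2.symm)).mono ?_ subset_rfl)
  have : (1 + (L + 1) : ℝ≥0) ≤ n := hN.trans (by exact_mod_cast hnN)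
  exact_mod_cast this

/-- A geodesic ray on which the horofunction tends to infinity at unit speed has a tail in a single
component of the complement of the horoball. -/
theorem mem_connectedComponentIn_of_le {X : Type*} [MetricSpace X] {h : X → ℝ}
    {c : GeodesicRay X} (hc : ∀ t : ℝ≥0, t ≤ h (c t)) {t : ℝ≥0} (ht : 1 ≤ t) :
    c t ∈ connectedComponentIn {q | h q ≤ 0}ᶜ (c 1) := by
  have hpre : IsPreconnected (c '' Ici 1) :=
    isPreconnected_Ici.image _ c.isometry.continuous.continuousOn
  refine hpre.subset_connectedComponentIn ⟨1, self_mem_Ici, rfl⟩ ?_ ⟨t, ht, rfl⟩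
  rintro _ ⟨s, hs, rfl⟩
  have h1 : (1 : ℝ) ≤ s := hs
  rw [mem_compl_iff, mem_ofPred_eq, not_le]
  linarith [hc s]

/-! ### Convergence to the boundary -/

/-- A sequence with unbounded distance from `p` subconverges to the endpoint of a ray from `p`, in
the sense that geodesics from `p` to its points pass close to every point of the ray. -/
theorem exists_subseq_ray_dist_le {X : Type*} [MetricSpace X] [ProperSpace X]
    (hX : IsGeodesicSpace X) (p : X) {x : ℕ → X}
    (hx : Tendsto (fun n => dist p (x n)) atTop atTop) :
    ∃ (φ : ℕ → ℕ) (b : GeodesicRay X), StrictMono φ ∧ b 0 = p ∧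
      ∀ t : ℝ≥0, ∀ᶠ n in atTop, dist (b t) (x (φ n)) ≤ dist p (x (φ n)) - t + 1 := by
  choose γ hγ using fun n => hX p (x n)
  have h0 := fun n => (hγ n).source
  have h1 := fun n => (hγ n).target
  have hd := fun n => (hγ n).dist_eq
  have mem : ∀ n (t : ℝ≥0), min (t : ℝ) (dist p (x n)) ∈ Icc 0 (dist p (x n)) := fun n t =>
    ⟨le_min t.coe_nonneg dist_nonneg, min_le_right _ _⟩
  -- Segments are made constant beyond `x n`, which is invisible at a fixed time once `x n` is far
  -- away.
  obtain ⟨φ, b, hφ, hb⟩ := exists_subseq_tendsto_of_lipschitz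
    (fun n (t : ℝ≥0) => γ n (min (t : ℝ) (dist p (x n))))
    (fun n s t => by
      rw [hd n _ (mem n s) _ (mem n t), NNReal.dist_eq]
      exact abs_inf_sub_inf_le_abs _ _ _)
    fun t => ⟨p, t, fun n => by
      have e := hd n _ (mem n t) _ ⟨le_rfl, dist_nonneg⟩
      rw [h0, sub_zero, abs_of_nonneg (mem n t).1] at e
      exact e.trans_le (min_le_left _ _)⟩
  have hx' : ∀ t : ℝ≥0, ∀ᶠ n in atTop, (t : ℝ) ≤ dist p (x (φ n)) := fun t =>
    (hx.comp hφ.tendsto_atTop).eventually_ge_atTop (t : ℝ)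
  refine ⟨φ, ⟨b, Isometry.of_dist_eq fun s t => ?_⟩, hφ, ?_, fun t => ?_⟩
  · refine tendsto_nhds_unique ((hb s).dist (hb t)) (tendsto_const_nhds.congr' ?_)
    filter_upwards [hx' s, hx' t] with n hs ht
    rw [hd _ _ (mem _ s) _ (mem _ t), min_eq_left hs, min_eq_left ht, NNReal.dist_eq]
  · refine tendsto_nhds_unique (hb 0) (tendsto_const_nhds.congr fun n => ?_)
    rw [NNReal.coe_zero, min_eq_left dist_nonneg, h0]
  · filter_upwards [hx' t, (hb t).eventually (Metric.ball_mem_nhds _ one_pos)] with n ht hn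
    rw [min_eq_left ht] at hn
    have e := hd (φ n) t ⟨t.coe_nonneg, ht⟩ _ ⟨dist_nonneg, le_rfl⟩
    rw [h1, abs_of_nonpos (by linarith)] at e
    have h2 := dist_triangle_left (b t) (x (φ n)) (γ (φ n) t)
    have h3 : dist (γ (φ n) t) (b t) < 1 := hn
    change dist (b t) _ ≤ _
    linarith

/-- The hypothesis bounds the Gromov product of `b t` and `x n` at `b 0` below by `t - 1/2`. For a
ray `c` within `K` of `b`, going out to time `r + K + 1` leaves a product of at least `r` at `c 0`,
and thinness applies at time `r`. -/
theorem convergesToBoundary_of_dist_le {X : Type*} [MetricSpace X] {δ : ℝ}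
    (hX : IsHyperbolicSpace X δ) {x : ℕ → X} {b : GeodesicRay X}
    (hb : ∀ t : ℝ≥0, ∀ᶠ n in atTop, dist (b t) (x n) ≤ dist (b 0) (x n) - t + 1) :
    ConvergesToBoundary δ x b.endpoint := by
  intro D hD c hc r
  obtain ⟨K, hK⟩ := Quotient.exact hc
  have hK0 : 0 ≤ K := dist_nonneg.trans (hK 0)
  lift K to ℝ≥0 using hK0
  filter_upwards [hb (r + K + 1)] with n hn
  obtain ⟨γ, hγ⟩ := hX.geodesic (c 0) (x n)
  have hdist : dist (c 0) (c (r + K + 1)) = r + K + 1 := by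
    rw [c.dist_eq, NNReal.coe_zero, zero_sub, abs_neg, abs_of_nonneg (NNReal.coe_nonneg _)]
    push_cast
    rfl
  have h1 := dist_triangle (b 0) (c 0) (x n)
  have h2 := dist_triangle (c (r + K + 1)) (b (r + K + 1)) (x n)
  have h3 := hK 0
  have h4 := hK (r + K + 1)
  have h5 := dist_triangle_right (c 0) (c (r + K + 1)) (x n)
  rw [dist_comm (b 0) (c 0)] at h1
  push_cast at hn
  have hprod : (r : ℝ) ≤ gromovProduct (c 0) (x n) (c (r + K + 1)) := by
    rw [gromovProduct, dist_comm (c (r + K + 1)) (c 0), hdist, dist_comm (x n), dist_comm (x n)]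
    linarith
  have hr : (r : ℝ) ≤ dist (c 0) (x n) := by
    refine hprod.trans ?_
    rw [gromovProduct, dist_comm (c (r + K + 1)) (c 0), dist_comm (x n), dist_comm (x n)]
    linarith
  have hc' : IsGeodesicSegment (fun t : ℝ => c t.toNNReal) (c 0) (c (r + K + 1)) := by
    refine ⟨by simp, ?_, fun s hs t ht => ?_⟩
    · have h6 : ((r : ℝ) + K + 1).toNNReal = r + K + 1 := by
        rw [← Real.toNNReal_coe (r := r + K + 1)]; push_cast; rfl
      simp only [hdist, h6]
    · rw [c.dist_eq, Real.coe_toNNReal _ hs.1, Real.coe_toNNReal _ ht.1]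
  refine ⟨γ, hγ, ?_⟩
  rw [min_eq_left hr]
  have := hX.thin _ _ _ _ _ hγ hc' r r.coe_nonneg hprod
  simp only [Real.toNNReal_coe] at this
  linarith [hX.nonneg]

/-- Along a ray towards the center the horofunction decreases, so a ray on which it is nonnegative
ends elsewhere. -/
theorem endpoint_ne_of_nonneg {X : Type*} [MetricSpace X] {x : ℕ → X} {r : ℕ → ℝ} {h : X → ℝ}
    (hh : ∀ q, Tendsto (fun n => dist q (x n) - r n) atTop (𝓝 (h q))) {b c : GeodesicRay X}
    (hb : ∀ t : ℝ≥0, ∀ᶠ n in atTop, dist (b t) (x n) ≤ dist (b 0) (x n) - t + 1)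
    (hc : ∀ t, 0 ≤ h (c t)) : c.endpoint ≠ b.endpoint := by
  intro he
  obtain ⟨K, hK⟩ := Quotient.exact he
  obtain ⟨t, ht⟩ : ∃ t : ℝ≥0, h (b 0) + 1 + K < t :=
    ⟨(h (b 0) + 1 + K).toNNReal + 1, by
      push_cast; linarith [Real.le_coe_toNNReal (h (b 0) + 1 + K)]⟩
  have : h (c t) ≤ h (b 0) + (1 + K - t) := by
    refine le_of_tendsto_of_tendsto (hh (c t)) ((hh (b 0)).add_const _) ?_
    filter_upwards [hb t] with n hn
    have := hK t
    linarith [dist_triangle (c t) (b t) (x n)]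
  linarith [hc t]

/-! ### One-endedness and the separating horoball -/

/-- In a one-ended space the limit of the balls of `SeparatedRays` is not compact. -/
theorem IsOneEnded.not_isCompact_of_notMem {X : Type*} [MetricSpace X] (hend : IsOneEnded X)
    {h : X → ℝ} {c c' : GeodesicRay X} (hc : ∀ t : ℝ≥0, t ≤ h (c t))
    (hc' : ∀ t : ℝ≥0, t ≤ h (c' t))
    (hne : c' 1 ∉ connectedComponentIn {q | h q ≤ 0}ᶜ (c 1)) : ¬ IsCompact {q | h q ≤ 0} := by
  intro hB
  -- With the sublevel set itself as the compact set, the tails of `c` and `c'` share a component,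
  -- which contains `c 1` and `c' 1`.
  obtain ⟨N, a, -, hN⟩ := hend.2 c c' c.isProperRay c'.isProperRay _ hB
  obtain ⟨h1, h2⟩ := hN (max N 1) (le_max_left _ _)
  have e1 := connectedComponentIn_eq h1
  have e2 := connectedComponentIn_eq h2
  have e3 := connectedComponentIn_eq (mem_connectedComponentIn_of_le hc (le_max_right N 1))
  have e4 := connectedComponentIn_eq (mem_connectedComponentIn_of_le hc' (le_max_right N 1))
  rw [e3, ← e1, e2, ← e4] at hne
  refine hne (mem_connectedComponentIn ?_)
  have := hc' 1
  simp only [mem_compl_iff, mem_ofPred_eq, not_le]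
  exact lt_of_lt_of_le one_pos (by simpa using this)

theorem mainTheorem8 {X : Type*} [MetricSpace X] {G : Type*} [Group G] [MulAction G X]
    (δ C M : ℝ) (hX : IsHyperbolicSpace X δ) (hG : IsGeometricAction G X)
    (hC : IsAlmostExtendabilityConstant X C) (hM : 0 < M) (hfail : ¬ DoubleDagger X C M)
    (hend : IsOneEnded X) :
    ∃ (η : BoundaryAtInfinity X) (B : Set X),
      IsHoroball δ η B ∧ IsEssentiallySeparating η B := by
  obtain ⟨ρ₀, hρ₀, hball⟩ := hG.exists_isCompact_closedBall
  have := hX.geodesic.properSpace hρ₀ hball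
  obtain ⟨p, ρ, hsep⟩ := exists_separatedRays hX.geodesic hG hC hfail
  choose x₀ r₀ u₀ v₀ H₀ using fun n : ℕ => hsep n
  obtain ⟨φ, h, c, c', hφ, hh, hu, hv⟩ := SeparatedRays.exists_subseq H₀
  set x := fun n => x₀ (φ n)
  set r := fun n => r₀ (φ n)
  have H : ∀ n : ℕ, SeparatedRays p ρ (2 * C) n (x n) (r n) (u₀ (φ n)) (v₀ (φ n)) := fun n =>
    { H₀ (φ n) with
      not_joined := fun hj => (H₀ (φ n)).not_joined
        (hj.mono (by exact_mod_cast hφ.le_apply) subset_rfl) }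
  have hne := SeparatedRays.notMem_connectedComponentIn hX.geodesic H hh (hu 1) (hv 1)
  have hc : ∀ t : ℝ≥0, t ≤ h (c t) := fun t =>
    le_of_tendsto_away hh (hu t) fun n => (H n).away_left t
  have hc' : ∀ t : ℝ≥0, t ≤ h (c' t) := fun t =>
    le_of_tendsto_away hh (hv t) fun n => (H n).away_right t
  have hr : Tendsto r atTop atTop := by
    by_contra hr
    simp only [tendsto_atTop, not_forall, not_eventually, not_le] at hr
    obtain ⟨R, hR⟩ := hr
    refine hend.not_isCompact_of_notMem hc hc' hne (Metric.isCompact_of_isClosed_isBounded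
      (isClosed_le (continuous_of_tendsto_dist_sub hh) continuous_const)
      ((Metric.isBounded_closedBall (x := p) (r := R + 1 + (R + 2 * C) + ρ)).subset
        fun q hq => ?_))
    -- Some `n` has both `r n < R` and `dist q (x n) < r n + 1`; the route from `q` to `p` through
    -- `x n` and `u₀ (φ n) 0` gives the radius.
    obtain ⟨n, hn, hn'⟩ := (hR.and_eventually ((hh q).eventually
      (gt_mem_nhds (lt_of_le_of_lt hq one_pos)))).exists
    have h1 := (H n).start
    have h2 := (H n).dist_left
    have h4 := dist_triangle4 q (x n) (u₀ (φ n) 0) p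
    rw [dist_comm (x n)] at h4
    rw [Metric.mem_closedBall]
    linarith
  have hx : Tendsto (fun n => dist p (x n)) atTop atTop := by
    refine tendsto_atTop_mono (fun n => ?_) (tendsto_atTop_add_const_right _ (-ρ) hr)
    have h0 := (H n).away_left 0
    rw [NNReal.coe_zero] at h0
    linarith [(H n).dist_left, dist_triangle (u₀ (φ n) 0) p (x n)]
  obtain ⟨ψ, b, hψ, rfl, hb⟩ := exists_subseq_ray_dist_le hX.geodesic p hx
  have hhψ : ∀ q, Tendsto (fun n => dist q (x (ψ n)) - r (ψ n)) atTop (𝓝 (h q)) := fun q =>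
    (hh q).comp hψ.tendsto_atTop
  have hmem : ∀ {w : GeodesicRay X}, (∀ t : ℝ≥0, t ≤ h (w t)) → w 1 ∈ {q | h q ≤ 0}ᶜ := by
    intro w hw
    simp only [mem_compl_iff, mem_ofPred_eq, not_le]
    exact lt_of_lt_of_le one_pos (by simpa using hw 1)
  have hray : ∀ {w : GeodesicRay X}, (∀ t : ℝ≥0, t ≤ h (w t)) →
      ∃ w' : GeodesicRay X, (∀ t, w' t ∈ connectedComponentIn {q | h q ≤ 0}ᶜ (w 1)) ∧
        w'.endpoint ≠ b.endpoint := fun {w} hw =>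
    -- Starting at time 1 keeps the whole ray in `{h > 0}`; at time 0 only `0 ≤ h` is known.
    ⟨w.shift 1, fun t => mem_connectedComponentIn_of_le hw le_self_add,
      endpoint_ne_of_nonneg hhψ hb fun t => (NNReal.coe_nonneg _).trans (hw (1 + t))⟩
  refine ⟨b.endpoint, {q | h q ≤ 0}, ⟨x ∘ ψ, r ∘ ψ, h, convergesToBoundary_of_dist_le hX hb, hhψ,
    rfl⟩, c 1, hmem hc, c' 1, hmem hc', fun he => hne ?_, hray hc, hray hc'⟩
  rw [he]
  exact mem_connectedComponentIn (hmem hc')
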